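/- Let $p\in\{2,3\}$, let $G$ be a finite group, and let $B$ be a Brauer $p$-block of $G$ with nontrivial defect group $D$. Let $\mathbb{Q}^{ab}\subseteq\mathbb{C}$ be the field generated over $\mathbb{Q}$ by all roots of unity, and let $\sigma_1\in\mathrm{Gal}(\mathbb{Q}^{ab}/\mathbb{Q})$ be the automorphism that fixes every root of unity of order not divisible by $p$ and sends every root of unity of $p$-power order to its $(p+1)$st power. Let $\mathrm{Irr}_0(B)$ be the set of irreducible complex characters $\chi$ of $G$ lying in $B$ that have height zero, i.e. such that $\chi(1)_p=|G:D|_p$, where $n_p$ denotes the largest power of $p$ dividing $n$. Let $\mathrm{Irr}_0(B)^{\sigma_1}$ be the set of those $\chi\in\mathrm{Irr}_0(B)$ with $\sigma_1(\chi(g))=\chi(g)$ for all $g\in G$. Then $p$ divides $|\mathrm{Irr}_0(B)^{\sigma_1}|$. -/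

import Mathlib

noncomputable section

/-! ### The Galois automorphism `σ₁` of `ℚ^ab` -/

/-- `ℚ^ab`, realized inside `ℂ` as the field generated over `ℚ` by all complex roots of unity. -/
abbrev QAb : IntermediateField ℚ ℂ :=
  IntermediateField.adjoin ℚ {z : ℂ | ∃ n : ℕ, n ≠ 0 ∧ z ^ n = 1}

/-- The defining property of `σ₁ ∈ Gal(ℚ^ab/ℚ)` (for the prime `p`): it fixes all roots of unity
of order prime to `p`, and it sends every root of unity of `p`-power order to its `(p+1)`st power. -/
def IsSigmaOne (p : ℕ) (σ : Gal(QAb/ℚ)) : Prop :=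
  (∀ z : QAb, ∀ m : ℕ, ¬ p ∣ m → z ^ m = 1 → σ z = z) ∧
    ∀ z : QAb, ∀ k : ℕ, z ^ p ^ k = 1 → σ z = z ^ (p + 1)

theorem isCyclotomicExtension_QAb : IsCyclotomicExtension Set.univ ℚ QAb := by
  have h := IntermediateField.isCyclotomicExtension_adjoin_of_exists_isPrimitiveRoot
    (Set.univ : Set ℕ) ℚ ℂ (fun n _ hn => ⟨_, Complex.isPrimitiveRoot_exp n hn⟩)
  have e : {b : ℂ | ∃ n ∈ (Set.univ : Set ℕ), n ≠ 0 ∧ b ^ n = 1} =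
      {z : ℂ | ∃ n : ℕ, n ≠ 0 ∧ z ^ n = 1} := by ext; simp
  rw [e] at h
  exact h

theorem isClosed_setOf_gal_apply_eq {K L : Type*} [Field K] [Field L] [Algebra K L]
    [Algebra.IsIntegral K L] (z w : L) : IsClosed {σ : Gal(L/K) | σ z = w} := by
  by_cases h : ∃ τ : Gal(L/K), τ z = w
  · obtain ⟨τ, rfl⟩ := h
    have hc : IsClosed (MulAction.stabilizer Gal(L/K) z : Set Gal(L/K)) :=
      OpenSubgroup.isClosed ⟨_, stabilizer_isOpen_of_isIntegral (K := K) z⟩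
    convert hc.leftCoset τ using 1
    ext σ
    rw [mem_leftCoset_iff, SetLike.mem_coe, MulAction.mem_stabilizer_iff, mul_smul,
      inv_smul_eq_iff]
    rfl
  · push Not at h
    simp [h]

/-- For every `N`, some automorphism acts as `σ₁` should on the `N`th roots of unity. -/
theorem exists_sigmaOne_level (L : Type*) [Field L] [CharZero L] [i : Algebra ℚ L]
    [IsCyclotomicExtension Set.univ ℚ L] (p : ℕ) [hp : Fact p.Prime] (N : ℕ) (hN : N ≠ 0) :
    ∃ σ : Gal(L/ℚ), ∀ z : L, z ^ N = 1 →
      (∀ m : ℕ, ¬ p ∣ m → z ^ m = 1 → σ z = z) ∧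
        ∀ k : ℕ, z ^ p ^ k = 1 → σ z = z ^ (p + 1) := by
  obtain rfl : i = DivisionRing.toRatAlgebra := Subsingleton.elim _ _
  have : IsGalois ℚ L := IsCyclotomicExtension.isGalois Set.univ ℚ L
  obtain ⟨ζ, hζ⟩ := IsCyclotomicExtension.exists_isPrimitiveRoot (S := Set.univ) ℚ L
    (Set.mem_univ N) hN
  obtain ⟨a, m, hm, rfl⟩ := Nat.exists_eq_pow_mul_and_not_dvd hN p hp.out.ne_one
  have hcop : Nat.Coprime (p ^ a) m :=
    Nat.Coprime.pow_left a ((Nat.Prime.coprime_iff_not_dvd hp.out).2 hm)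
  obtain ⟨u, hu1, hu2⟩ := Nat.chineseRemainder hcop (p + 1) 1
  have hu : Nat.Coprime u (p ^ a * m) := by
    refine Nat.Coprime.mul_right ?_ ?_
    · have : Nat.gcd u (p ^ a) = Nat.gcd (p + 1) (p ^ a) := hu1.gcd_eq
      rw [Nat.coprime_iff_gcd_eq_one, this]
      exact Nat.Coprime.pow_right a (by simp)
    · have : Nat.gcd u m = Nat.gcd 1 m := hu2.gcd_eq
      rw [Nat.coprime_iff_gcd_eq_one, this]
      simp
  have hpos : 0 < p ^ a * m := Nat.pos_of_ne_zero hN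
  have hmin : minpoly ℚ (ζ ^ u) = minpoly ℚ ζ := by
    rw [← Polynomial.cyclotomic_eq_minpoly_rat hζ hpos,
      ← Polynomial.cyclotomic_eq_minpoly_rat (hζ.pow_of_coprime u hu) hpos]
  obtain ⟨σ, hσ⟩ := minpoly.exists_algEquiv_of_root' (K := ℚ) (x := ζ ^ u) (y := ζ)
    (Algebra.IsAlgebraic.isAlgebraic ζ) (by rw [← hmin]; exact minpoly.aeval _ _)
  refine ⟨σ, fun z hz => ?_⟩
  have : NeZero (p ^ a * m) := ⟨hN⟩
  obtain ⟨j, -, rfl⟩ := hζ.eq_pow_of_pow_eq_one hz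
  have hz' : σ (ζ ^ j) = (ζ ^ j) ^ u := by
    rw [map_pow, hσ, ← pow_mul, ← pow_mul, mul_comm]
  have hord := orderOf_dvd_of_pow_eq_one hz
  refine ⟨fun l hl h => ?_, fun k h => ?_⟩
  · have h1 : Nat.Coprime (orderOf (ζ ^ j)) (p ^ a) :=
      Nat.Coprime.coprime_dvd_left (orderOf_dvd_of_pow_eq_one h)
        (Nat.Coprime.pow_right a ((Nat.Prime.coprime_iff_not_dvd hp.out).2 hl).symm)
    have h2 : orderOf (ζ ^ j) ∣ m := h1.dvd_of_dvd_mul_left hord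
    exact hz'.trans ((pow_eq_pow_of_modEq (hu2.of_dvd h2) (pow_orderOf_eq_one _)).trans (pow_one _))
  · have h1 : Nat.Coprime (orderOf (ζ ^ j)) m :=
      Nat.Coprime.coprime_dvd_left (orderOf_dvd_of_pow_eq_one h)
        (Nat.Coprime.pow_left k ((Nat.Prime.coprime_iff_not_dvd hp.out).2 hm))
    have h2 : orderOf (ζ ^ j) ∣ p ^ a := h1.dvd_of_dvd_mul_right hord
    exact hz'.trans (pow_eq_pow_of_modEq (hu1.of_dvd h2) (pow_orderOf_eq_one _))

theorem exists_isSigmaOne (p : ℕ) [Fact p.Prime] : ∃ σ : Gal(QAb/ℚ), IsSigmaOne p σ := by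
  have := isCyclotomicExtension_QAb
  have : Algebra.IsIntegral ℚ QAb := IsCyclotomicExtension.integral (S := Set.univ) ℚ QAb
  have : IsGalois ℚ QAb := IsCyclotomicExtension.isGalois Set.univ ℚ QAb
  let t : ℕ → Set Gal(QAb/ℚ) := fun n => {σ | ∀ z : QAb, z ^ n.factorial = 1 →
      (∀ m : ℕ, ¬ p ∣ m → z ^ m = 1 → σ z = z) ∧
        ∀ k : ℕ, z ^ p ^ k = 1 → σ z = z ^ (p + 1)}
  have hcl : ∀ n, IsClosed (t n) := by
    intro n
    simp only [t, Set.ofPred_forall, Set.ofPred_and]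
    refine isClosed_iInter fun z => isClosed_iInter fun _ => IsClosed.inter ?_ ?_
    · exact isClosed_iInter fun _ => isClosed_iInter fun _ => isClosed_iInter fun _ =>
        isClosed_setOf_gal_apply_eq _ _
    · exact isClosed_iInter fun _ => isClosed_iInter fun _ => isClosed_setOf_gal_apply_eq _ _
  obtain ⟨σ, hσ⟩ := IsCompact.nonempty_iInter_of_sequence_nonempty_isCompact_isClosed t
    (fun n σ h z hz => h z (by rw [Nat.factorial_succ, mul_comm, pow_mul, hz, one_pow]))
    (fun n => exists_sigmaOne_level QAb p n.factorial n.factorial_ne_zero)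
    (hcl 0).isCompact hcl
  rw [Set.mem_iInter] at hσ
  have key : ∀ (z : QAb) (n : ℕ), n ≠ 0 → z ^ n = 1 → z ^ n.factorial = 1 := by
    intro z n hn h
    obtain ⟨c, hc⟩ := Nat.dvd_factorial (Nat.pos_of_ne_zero hn) le_rfl
    rw [hc, pow_mul, h, one_pow]
  refine ⟨σ, fun z m hm h => ?_, fun z k h => ?_⟩
  · exact (hσ m z (key z m (by rintro rfl; exact hm (dvd_zero p)) h)).1 m hm h
  · exact (hσ (p ^ k) z (key z _ (pow_ne_zero _ (Fact.out : p.Prime).ne_zero) h)).2 k h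

/-- The automorphism `σ₁ ∈ Gal(ℚ^ab/ℚ)`. It is determined by its defining property, since
`ℚ^ab` is generated by the roots of unity of `p`-power order and of order prime to `p`. -/
def sigmaOne (p : ℕ) [Fact p.Prime] : Gal(QAb/ℚ) := (exists_isSigmaOne p).choose

theorem sigmaOne_spec (p : ℕ) [Fact p.Prime] : IsSigmaOne p (sigmaOne p) :=
  (exists_isSigmaOne p).choose_spec

/-! ### Ordinary and Brauer characters -/

variable {G : Type*} [Group G]

/-- `Irr(G)`: the characters of the irreducible complex representations of `G`. -/
def OrdinaryIrr (G : Type*) [Group G] : Set (G → ℂ) :=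
  {χ | ∃ (n : ℕ) (ρ : Representation ℂ G (Fin n → ℂ)), ρ.IsIrreducible ∧ χ = ρ.character}

/-- `χ` is fixed by `σ`, that is `σ(χ(g)) = χ(g)` for all `g`
(the values of a character of a finite group lie in `ℚ^ab`). -/
def IsGaloisFixed (σ : Gal(QAb/ℚ)) (χ : G → ℂ) : Prop :=
  ∀ g : G, ∃ z : QAb, (z : ℂ) = χ g ∧ σ z = z

/-- The `p`-regular elements of `G`. -/
def PRegular (p : ℕ) (G : Type*) [Group G] : Type _ := {g : G // ¬ p ∣ orderOf g}

/-! In the rest of this file `R` is the ring of algebraic integers in `ℂ`, that is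
`integralClosure ℤ ℂ`, and `red : R → F` is a surjective ring homomorphism onto a field of
characteristic `p`; in other words, `red` is reduction modulo a maximal ideal `M` of `R`
containing `p`, and `F = R/M`. -/

variable {F : Type*} [Field F]

/-- The extension of the reduction map to the localization `S` of `R` at `M`:
`ReducesTo red z α` says that `z = r / s` with `r, s ∈ R`, `s ∉ M`, and `α` is the
image of `z` in `F`. -/
def ReducesTo (red : integralClosure ℤ ℂ →+* F) (z : ℂ) (α : F) : Prop :=
  ∃ r s : integralClosure ℤ ℂ, red s ≠ 0 ∧ z = (r : ℂ) / (s : ℂ) ∧ α = red r / red s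

open scoped Classical in
/-- The root of unity `ξ ∈ ℂ` of order prime to `p` that reduces to `α`. (For `0 ≠ α ∈ F`
there is exactly one; the value is irrelevant otherwise.) -/
def rootLift (p : ℕ) (red : integralClosure ℤ ℂ →+* F) (α : F) : ℂ :=
  if h : ∃ ξ : integralClosure ℤ ℂ, (∃ m : ℕ, ¬ p ∣ m ∧ ξ ^ m = 1) ∧ red ξ = α then
    (h.choose : ℂ) else 0

/-- The Brauer character of an `F`-representation: on a `p`-regular element, the sum of the lifts
of the eigenvalues, counted with multiplicity. -/
def brauerCharacter (p : ℕ) (red : integralClosure ℤ ℂ →+* F) {n : ℕ}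
    (ρ : Representation F G (Fin n → F)) : PRegular p G → ℂ :=
  fun g => (((ρ g.1).charpoly.roots).map (rootLift p red)).sum

/-! ### Brauer blocks -/

/-- `HasCentralCharacter p red θ lam` says that `θ` lies in `Irr(G)` or in `IBr(G)`, and that `lam`
is the central character `λ_θ` of `θ`, recorded by its values on the class sums of `F[G]`:
for `χ ∈ Irr(G)`, `λ_χ(K) = ω_χ(K)^*` with `ω_χ(K) = |K| χ(x) / χ(1)`, `x ∈ K`; for `φ ∈ IBr(G)`
afforded by `ρ`, the sum of the class `K` acts on `ρ` as the scalar `λ_φ(K)`. -/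
def HasCentralCharacter (p : ℕ) (red : integralClosure ℤ ℂ →+* F)
    (θ : (G → ℂ) ⊕ (PRegular p G → ℂ)) (lam : ConjClasses G → F) : Prop :=
  match θ with
  | .inl χ => χ ∈ OrdinaryIrr G ∧ ∀ x : G,
      ReducesTo red ((ConjClasses.mk x).carrier.ncard * χ x / χ 1) (lam (ConjClasses.mk x))
  | .inr φ => ∃ (n : ℕ) (ρ : Representation F G (Fin n → F)),
      ρ.IsIrreducible ∧ φ = brauerCharacter p red ρ ∧
        ∀ K : ConjClasses G, ∑ᶠ g ∈ K.carrier, ρ g = lam K • LinearMap.id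

/-- `B` is the block of `G` whose central character is `lam = λ_B`: a nonempty set consisting of
all the elements of `Irr(G) ∪ IBr(G)` with central character `lam`. -/
def IsBlockWithCentralCharacter (p : ℕ) (red : integralClosure ℤ ℂ →+* F)
    (B : Set ((G → ℂ) ⊕ (PRegular p G → ℂ))) (lam : ConjClasses G → F) : Prop :=
  B.Nonempty ∧ B = {θ | HasCentralCharacter p red θ lam}

/-- `B ∈ Bl(G)`: two elements of `Irr(G) ∪ IBr(G)` are in the same `p`-block if and only if they
have the same central character. -/
def IsBlock (p : ℕ) (red : integralClosure ℤ ℂ →+* F)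
    (B : Set ((G → ℂ) ⊕ (PRegular p G → ℂ))) : Prop :=
  ∃ lam, IsBlockWithCentralCharacter p red B lam

/-- `Irr(B) = B ∩ Irr(G)`. -/
def irrOfBlock {p : ℕ} (B : Set ((G → ℂ) ⊕ (PRegular p G → ℂ))) : Set (G → ℂ) :=
  {χ | Sum.inl χ ∈ B}

/-- The coefficient at `x` of `f_B = ∑_{χ ∈ Irr(B)} e_χ`, where
`e_χ = (χ(1)/|G|) ∑_x χ(x⁻¹) x` is the primitive central idempotent of `ℂ[G]` belonging to `χ`.
The block idempotent `e_B` of `F[G]` is the reduction of `f_B`. -/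
def blockIdempotentCoeff {p : ℕ} (B : Set ((G → ℂ) ⊕ (PRegular p G → ℂ))) (x : G) : ℂ :=
  ∑ᶠ χ ∈ irrOfBlock B, χ 1 / Nat.card G * χ x⁻¹

/-- The class of `x` is a defect class of the block `B`: the coefficient of `e_B` at `x` is
nonzero, and `λ_B` does not vanish at the sum of the class of `x`. -/
def IsDefectClass {p : ℕ} (red : integralClosure ℤ ℂ →+* F)
    (B : Set ((G → ℂ) ⊕ (PRegular p G → ℂ))) (x : G) : Prop :=
  (∃ α : F, α ≠ 0 ∧ ReducesTo red (blockIdempotentCoeff B x) α) ∧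
    ∃ lam, IsBlockWithCentralCharacter p red B lam ∧ lam (ConjClasses.mk x) ≠ 0

/-- `D` is a defect group of `B`: a Sylow `p`-subgroup of the centralizer `C_G(x)` of an element
`x` of a defect class of `B`. -/
def IsDefectGroup {p : ℕ} (red : integralClosure ℤ ℂ →+* F)
    (B : Set ((G → ℂ) ⊕ (PRegular p G → ℂ))) (D : Subgroup G) : Prop :=
  ∃ x : G, IsDefectClass red B x ∧
    ∃ P : Sylow p (Subgroup.centralizer {x} : Subgroup G),
      D = (P : Subgroup (Subgroup.centralizer {x} : Subgroup G)).map
        (Subgroup.centralizer {x} : Subgroup G).subtype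

/-- `Irr₀(B)`, for a block `B` with defect group `D`: the `χ ∈ Irr(B)` of height zero, that is
with `χ(1)_p = |G : D|_p`. -/
def irrHeightZero {p : ℕ} (B : Set ((G → ℂ) ⊕ (PRegular p G → ℂ))) (D : Subgroup G) :
    Set (G → ℂ) :=
  {χ | χ ∈ irrOfBlock B ∧ ∃ n : ℕ, χ 1 = n ∧ padicValNat p n = padicValNat p D.index}

end

/-! Let `K` be a defect class of `B`, with `x ∈ K`, and let `|K|_p = p^e`. A Sylow `p`-subgroup of
`C_G(x)` is a defect group, so `|G : D|_p = p^e`, and `D ≠ 1` forces `p ∣ |C_G(x)|`. Since `λ_B(K) ≠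
0`, every `χ ∈ Irr(B)` has degree `p^e d_χ` (`IsCentralCharacterFamily.pow_dvd_degree`), with height
zero exactly when `p ∤ d_χ`.

Choose a central element `z` of the group ring over the algebraic integers such that `ω_χ(z)`
vanishes outside `B` and reduces to one nonzero constant `u` on `B`
(`IsCentralCharacterFamily.exists_separating`). Column orthogonality evaluates `∑ ω_χ(K z) χ(1)²` as
`|G|` times the coefficient of `K z` at `1`, which is `|G| |K| z(x⁻¹) = |K|² |C_G(x)| z(x⁻¹)`.
Dividing by `p^(2e)` and reducing gives `λ_B(K) u ∑ d_χ² = 0` in `F`, so `p ∣ ∑ d_χ²`. For `p ≤ 3`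
the squares prime to `p` are `1` mod `p`, hence `p ∣ |Irr₀(B)|` (`dvd_ncard_irrHeightZero`).

Finally `σ₁` permutes `Irr₀(B)` with `p`-power order, so its fixed points have the same count mod
`p` (`ncard_fixed_modEq`). It preserves the block because roots of unity of `p`-power order reduce
to `1`, so reduction does not see `σ₁` (`red_eq_of_ringEquiv`). -/

noncomputable section

open Representation Module

/-! ### Orthogonality and the regular character -/

section Characters

variable {G : Type*} [Group G]

/-- Semilinearity lets one lemma serve both changes of basis and Galois twists of representations.
-/
theorem isIrreducible_of_semilinearEquiv {k : Type*} [Field k] {s s' : k →+* k}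
    [RingHomInvPair s s'] [RingHomInvPair s' s] {V W : Type*} [AddCommGroup V] [Module k V]
    [AddCommGroup W] [Module k W] {ρ : Representation k G V} {τ : Representation k G W}
    (e : V ≃ₛₗ[s] W) (he : ∀ g v, e (ρ g v) = τ g (e v)) (hρ : ρ.IsIrreducible) :
    τ.IsIrreducible := by
  have he' : ∀ g w, e.symm (τ g w) = ρ g (e.symm w) := fun g w => by
    rw [LinearEquiv.symm_apply_eq, he, LinearEquiv.apply_symm_apply]
  let f : Subrepresentation τ ≃o Subrepresentation ρ :=
    { toFun := fun U => ⟨U.toSubmodule.comap (e : V →ₛₗ[s] W), fun g v hv => by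
        have := U.apply_mem_toSubmodule g hv
        simpa [he] using this⟩
      invFun := fun U => ⟨U.toSubmodule.comap (e.symm : W →ₛₗ[s'] V), fun g v hv => by
        have := U.apply_mem_toSubmodule g hv
        simpa [he'] using this⟩
      left_inv := fun U => Subrepresentation.toSubmodule_injective (by ext; simp)
      right_inv := fun U => Subrepresentation.toSubmodule_injective (by ext; simp)
      map_rel_iff' := by
        intro U U'
        refine ⟨fun h w hw => ?_, fun h v hv => h hv⟩
        have hw' : e.symm w ∈ U.toSubmodule.comap (e : V →ₛₗ[s] W) := by
          simpa using (show w ∈ U.toSubmodule from hw)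
        have : e.symm w ∈ U'.toSubmodule.comap (e : V →ₛₗ[s] W) := h hw'
        have h2 : w ∈ U'.toSubmodule := by simpa using this
        exact h2 }
  exact f.isSimpleOrder

theorem character_mem_ordinaryIrr {V : Type*} [AddCommGroup V] [Module ℂ V]
    [FiniteDimensional ℂ V] (ρ : Representation ℂ G V) (hρ : ρ.IsIrreducible) :
    ρ.character ∈ OrdinaryIrr G := by
  let e : V ≃ₗ[ℂ] (Fin (finrank ℂ V) → ℂ) := (finBasis ℂ V).equivFun
  let τ : Representation ℂ G (Fin (finrank ℂ V) → ℂ) :=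
    (e.conjAlgEquiv ℂ).toAlgHom.toMonoidHom.comp ρ
  have he : ∀ g v, e (ρ g v) = τ g (e v) := fun g v => by simp [τ, LinearEquiv.conjAlgEquiv]
  exact ⟨_, τ, isIrreducible_of_semilinearEquiv e he hρ,
    char_iso (.mk e fun g => LinearMap.ext fun v => he g v)⟩

theorem exists_pos_nat_of_mem_ordinaryIrr {χ : G → ℂ} (hχ : χ ∈ OrdinaryIrr G) :
    ∃ n : ℕ, 0 < n ∧ χ 1 = n := by
  obtain ⟨n, ρ, hρ, rfl⟩ := hχ
  refine ⟨n, Nat.pos_of_ne_zero ?_, by simp⟩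
  rintro rfl
  obtain ⟨U, U', h⟩ := hρ.toNontrivial
  exact h (Subrepresentation.toSubmodule_injective (Subsingleton.elim _ _))

theorem sum_mul_inv_of_mem_ordinaryIrr [Fintype G] [DecidableEq (G → ℂ)] {χ ψ : G → ℂ}
    (hχ : χ ∈ OrdinaryIrr G) (hψ : ψ ∈ OrdinaryIrr G) :
    ∑ g, χ g * ψ g⁻¹ = if χ = ψ then (Nat.card G : ℂ) else 0 := by
  obtain ⟨n, ρ, hρ, rfl⟩ := hχ
  obtain ⟨m, τ, hτ, rfl⟩ := hψ
  have h0 : (Nat.card G : ℂ) ≠ 0 := by simp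
  let _ : Invertible (Nat.card G : ℂ) := invertibleOfNonzero h0
  split_ifs with h
  · have := char_orthonormal ρ ρ
    rw [← h]
    rw [if_pos ⟨Representation.Equiv.refl ρ⟩, inv_mul_eq_iff_eq_mul₀ h0, mul_one] at this
    exact this
  · have := char_orthonormal ρ τ
    rw [if_neg, inv_mul_eq_iff_eq_mul₀ h0, mul_zero] at this
    · exact this
    · rintro ⟨φ⟩
      exact h (char_iso φ).symm

/-- The representation of `G` on the functions on `G` by left translation. -/
def translationRep (G : Type*) [Group G] : Representation ℂ G (G → ℂ) where
  toFun g := LinearMap.funLeft ℂ ℂ (fun x => g⁻¹ * x)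
  map_one' := by ext; simp [LinearMap.funLeft]
  map_mul' g h := by ext; simp [LinearMap.funLeft, mul_assoc]

theorem character_translationRep [Fintype G] [DecidableEq G] (g : G) :
    (translationRep G).character g = if g = 1 then (Nat.card G : ℂ) else 0 := by
  rw [character, LinearMap.trace_eq_matrix_trace ℂ (Pi.basisFun ℂ G), Matrix.trace]
  simp only [Matrix.diag, LinearMap.toMatrix_apply, Pi.basisFun_repr, Pi.basisFun_apply]
  simp only [translationRep, MonoidHom.coe_mk, OneHom.coe_mk, LinearMap.funLeft_apply,
    Pi.single_apply, mul_eq_right, inv_eq_one]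
  split_ifs <;> simp

variable [Finite G]

/-- Maschke's theorem splits off an invariant complement; induction on the dimension does the rest.
-/
theorem exists_character_eq_sum (n : ℕ) : ∀ {V : Type*} [AddCommGroup V] [Module ℂ V]
    [FiniteDimensional ℂ V] (ρ : Representation ℂ G V), finrank ℂ V = n →
    ∃ l : Multiset (G → ℂ), (∀ χ ∈ l, χ ∈ OrdinaryIrr G) ∧ ρ.character = l.sum := by
  induction n using Nat.strong_induction_on with
  | _ n ih =>
  intro V _ _ _ ρ hn
  rcases subsingleton_or_nontrivial V with hV | hV
  · refine ⟨0, by simp, ?_⟩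
    ext g
    simp [character, Subsingleton.elim (ρ g) 0]
  have : Nontrivial (Subrepresentation ρ) := by
    refine ⟨⊥, ⊤, fun h => ?_⟩
    exact bot_ne_top (congrArg Subrepresentation.toSubmodule h)
  by_cases hirr : ρ.IsIrreducible
  · exact ⟨{ρ.character}, by simpa using character_mem_ordinaryIrr ρ hirr, by simp⟩
  have : ComplementedLattice (Subrepresentation ρ) := by
    rw [← IsSemisimpleRepresentation, isSemisimpleRepresentation_iff_isSemisimpleModule_asModule]
    have : NeZero (Nat.card G : ℂ) := ⟨Nat.cast_ne_zero.2 Nat.card_pos.ne'⟩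
    infer_instance
  obtain ⟨W, hW0, hW1⟩ : ∃ W : Subrepresentation ρ, W ≠ ⊥ ∧ W ≠ ⊤ := by
    by_contra! h
    exact hirr ⟨fun W => or_iff_not_imp_left.2 (h W)⟩
  obtain ⟨W', hc⟩ := exists_isCompl W
  have hc' : IsCompl W.toSubmodule W'.toSubmodule := by
    refine ⟨disjoint_iff.2 ?_, codisjoint_iff.2 ?_⟩
    · exact congrArg Subrepresentation.toSubmodule hc.inf_eq_bot
    · exact congrArg Subrepresentation.toSubmodule hc.sup_eq_top
  have hsum := Submodule.finrank_add_eq_of_isCompl hc'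
  have hpos : finrank ℂ W.toSubmodule ≠ 0 := by
    rw [Ne, Submodule.finrank_eq_zero]
    exact fun h => hW0 (Subrepresentation.toSubmodule_injective h)
  have hpos' : finrank ℂ W'.toSubmodule ≠ 0 := by
    rw [Ne, Submodule.finrank_eq_zero]
    intro h
    have h' : W' = ⊥ := Subrepresentation.toSubmodule_injective h
    rw [h'] at hc
    exact hW1 (by simpa using hc.sup_eq_top)
  obtain ⟨l, hl, h1⟩ := ih _ (by omega) W.toRepresentation rfl
  obtain ⟨l', hl', h2⟩ := ih _ (by omega) W'.toRepresentation rfl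
  refine ⟨l + l', fun χ hχ => (Multiset.mem_add.1 hχ).elim (hl χ) (hl' χ), ?_⟩
  rw [Multiset.sum_add, ← h1, ← h2]
  ext g
  have hint := DirectSum.isInternal_submodule_iff_isCompl
    (fun i : Bool => bif i then W.toSubmodule else W'.toSubmodule) (i := true) (j := false)
    (by simp) (by ext i; cases i <;> simp) |>.2 hc'
  have := LinearMap.trace_eq_sum_trace_restrict hint (f := ρ g) (by
    rintro (_ | _) v hv
    · exact W'.apply_mem_toSubmodule g hv
    · exact W.apply_mem_toSubmodule g hv)
  rw [character, this, Fintype.sum_bool]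
  rfl

/-- Pairing the regular character with `χ` leaves only the term at `1`, so `χ` has multiplicity
`χ(1)`. Both the finiteness of `Irr(G)` and column orthogonality against `1` follow. -/
theorem exists_regular_decomposition [DecidableEq (G → ℂ)] [DecidableEq G] :
    ∃ l : Multiset (G → ℂ), (∀ χ, χ ∈ l ↔ χ ∈ OrdinaryIrr G) ∧
    (∀ χ ∈ OrdinaryIrr G, (l.count χ : ℂ) = χ 1) ∧
    ∀ g, l.sum g = if g = 1 then (Nat.card G : ℂ) else 0 := by
  have := Fintype.ofFinite G
  obtain ⟨l, hl, h⟩ := exists_character_eq_sum _ (translationRep G) rfl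
  have h0 : (Nat.card G : ℂ) ≠ 0 := by simp
  have hcount : ∀ χ ∈ OrdinaryIrr G, (l.count χ : ℂ) = χ 1 := by
    intro χ hχ
    have h1 : ∑ g, l.sum g * χ g⁻¹ = Nat.card G * χ 1 := by
      simp [← h, character_translationRep]
    have h2 : ∑ g, l.sum g * χ g⁻¹ = Nat.card G * l.count χ := by
      have h3 : ∀ l : Multiset (G → ℂ), (∀ ψ ∈ l, ψ ∈ OrdinaryIrr G) →
          ∑ g, l.sum g * χ g⁻¹ = Nat.card G * l.count χ := by
        intro l
        induction l using Multiset.induction_on with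
        | empty => simp
        | cons ψ l ih =>
          intro hl
          simp only [Multiset.sum_cons, Pi.add_apply, add_mul, Finset.sum_add_distrib]
          rw [ih fun ψ hψ => hl ψ (Multiset.mem_cons_of_mem hψ),
            sum_mul_inv_of_mem_ordinaryIrr (hl ψ (Multiset.mem_cons_self _ _)) hχ,
            Multiset.count_cons]
          simp only [eq_comm (a := χ)]
          split_ifs <;> push_cast <;> ring
      exact h3 l hl
    exact mul_left_cancel₀ h0 (h2.symm.trans h1)
  refine ⟨l, fun χ => ⟨hl χ, fun hχ => ?_⟩, hcount, fun g => ?_⟩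
  · rw [← Multiset.count_ne_zero]
    intro hc
    have h1 := hcount χ hχ
    rw [hc] at h1
    obtain ⟨n, hn, h2⟩ := exists_pos_nat_of_mem_ordinaryIrr hχ
    rw [h2] at h1
    exact hn.ne (Nat.cast_injective h1)
  · rw [← h, character_translationRep]

theorem finite_ordinaryIrr : (OrdinaryIrr G).Finite := by
  classical
  obtain ⟨l, hl, -⟩ := exists_regular_decomposition (G := G)
  refine l.toFinset.finite_toSet.subset fun χ hχ => ?_
  simpa [hl] using hχ

theorem sum_apply_one_mul_apply [DecidableEq G] (g : G) :
    ∑ χ ∈ (finite_ordinaryIrr (G := G)).toFinset, χ 1 * χ g =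
      if g = 1 then (Nat.card G : ℂ) else 0 := by
  classical
  obtain ⟨l, hl, hc, hs⟩ := exists_regular_decomposition (G := G)
  have : finite_ordinaryIrr.toFinset = l.toFinset := by ext; simp [hl]
  have h := congrFun (Finset.sum_multiset_count l) g
  rw [this, ← hs, h, Finset.sum_apply]
  refine Finset.sum_congr rfl fun χ hχ => ?_
  rw [← hc χ (by simpa [hl] using hχ)]
  simp

end Characters

/-! ### Character values as sums of roots of unity -/

section CharacterValues

variable {G : Type*} [Group G]

/-- The restriction to the abelian group `⟨g⟩` is a sum of linear characters; their values at `g`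
are the eigenvalues. -/
theorem exists_eigenvalues [Finite G] {χ : G → ℂ} (hχ : χ ∈ OrdinaryIrr G) (g : G) :
    ∃ l : Multiset ℂ, (∀ ζ ∈ l, ζ ^ Nat.card G = 1) ∧
      ∀ k : ℕ, χ (g ^ k) = (l.map (· ^ k)).sum := by
  obtain ⟨n, ρ, -, rfl⟩ := hχ
  let h : Subgroup.zpowers g := ⟨g, Subgroup.mem_zpowers g⟩
  obtain ⟨l, hl, hsum⟩ := exists_character_eq_sum _
    (ρ.comp (Subgroup.zpowers g).subtype : Representation ℂ (Subgroup.zpowers g) (Fin n → ℂ)) rfl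
  have hpow : ∀ ψ ∈ l, ∀ k : ℕ, ψ (h ^ k) = ψ h ^ k := by
    intro ψ hψ k
    obtain ⟨m, τ, hτ, rfl⟩ := hl ψ hψ
    obtain rfl : m = 1 := by
      simpa using IsIrreducible.finrank_eq_one_of_isMulCommutative τ
    have htr : ∀ a, τ.character a = LinearMap.toMatrix' (τ a) 0 0 := by
      intro a
      rw [character, LinearMap.trace_eq_matrix_trace ℂ (Pi.basisFun ℂ (Fin 1)),
        Matrix.trace_fin_one]
      rfl
    induction k with
    | zero => simp
    | succ k ih =>
      rw [pow_succ, pow_succ, ← ih, htr, htr, htr, map_mul, LinearMap.toMatrix'_mul,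
        Matrix.mul_apply, Fin.sum_univ_one]
  refine ⟨l.map (· h), ?_, fun k => ?_⟩
  · intro ζ hζ
    obtain ⟨ψ, hψ, rfl⟩ := Multiset.mem_map.1 hζ
    have hh : h ^ Nat.card G = 1 := Subtype.ext (by simp [h])
    rw [← hpow ψ hψ, hh]
    simpa using hpow ψ hψ 0
  · have h1 : ρ.character (g ^ k) = l.sum (h ^ k) := by
      rw [← hsum]
      rfl
    rw [h1, Multiset.map_map]
    have h2 : ∀ l : Multiset (Subgroup.zpowers g → ℂ), l.sum (h ^ k) = (l.map (· (h ^ k))).sum := by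
      intro l
      induction l using Multiset.induction_on with
      | empty => simp
      | cons ψ l ih => simp [ih]
    rw [h2]
    exact congrArg _ (Multiset.map_congr rfl fun ψ hψ => hpow ψ hψ k)

theorem isIntegral_apply [Finite G] {χ : G → ℂ} (hχ : χ ∈ OrdinaryIrr G) (g : G) :
    IsIntegral ℤ (χ g) := by
  obtain ⟨l, hl, h⟩ := exists_eigenvalues hχ g
  have h1 := h 1
  simp only [pow_one, Multiset.map_id'] at h1
  rw [h1]
  refine IsIntegral.multiset_sum fun ζ hζ => ?_
  exact IsIntegral.of_pow Nat.card_pos (by rw [hl ζ hζ]; exact isIntegral_one)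

end CharacterValues

/-- The ring of algebraic integers in `ℂ`. -/
abbrev AlgInt := integralClosure ℤ ℂ

/-- The centre of the group ring of `G` over the algebraic integers. -/
abbrev GroupRingCenter (G : Type*) [Group G] :=
  Subalgebra.center AlgInt (MonoidAlgebra AlgInt G)

/-! ### Central characters of the integral group ring -/

section CentralCharacters

variable {G : Type*} [Group G]

theorem apply_eq_of_mem_carrier {χ : G → ℂ} (hχ : χ ∈ OrdinaryIrr G) {x g : G}
    (hg : g ∈ (ConjClasses.mk x).carrier) : χ g = χ x := by
  obtain ⟨n, ρ, -, rfl⟩ := hχ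
  rw [ConjClasses.mem_carrier_iff_mk_eq, ConjClasses.mk_eq_mk_iff_isConj] at hg
  obtain ⟨c, rfl⟩ := isConj_iff.1 hg
  simp

variable [Fintype G]

/-- By Schur's lemma a central element acts as a scalar, which is integral because the group ring is
finite over `AlgInt`. The formula compares traces. -/
theorem exists_centralCharacter {χ : G → ℂ} (hχ : χ ∈ OrdinaryIrr G) :
    ∃ ω : GroupRingCenter G →ₐ[AlgInt] AlgInt,
      ∀ z, (ω z : ℂ) * χ 1 = ∑ g, (z.1.coeff g : ℂ) * χ g := by
  obtain ⟨n, hn, h1⟩ := exists_pos_nat_of_mem_ordinaryIrr hχ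
  obtain ⟨m, ρ, hρ, rfl⟩ := hχ
  obtain rfl : m = n := by
    rw [char_one] at h1
    simpa using h1
  have : NeZero m := ⟨hn.ne'⟩
  let L := MonoidAlgebra.lift AlgInt (Module.End ℂ (Fin m → ℂ)) G ρ
  have hL : ∀ z : GroupRingCenter G, ∃ c : ℂ, L z.1 = algebraMap ℂ _ c := by
    intro z
    let f : IntertwiningMap ρ ρ := ⟨L z.1, fun g => by
      have h := congrArg L (Subalgebra.mem_center_iff.1 z.2 (MonoidAlgebra.of AlgInt G g))
      rw [map_mul, map_mul, MonoidAlgebra.lift_of] at h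
      exact h.symm⟩
    obtain ⟨c, hc⟩ :=
      (IsIrreducible.algebraMap_intertwiningMap_bijective_of_isAlgClosed (ρ := ρ)).2 f
    exact ⟨c, (congrArg IntertwiningMap.toLinearMap hc).symm⟩
  choose c hc using hL
  have hinj : Function.Injective (algebraMap ℂ (Module.End ℂ (Fin m → ℂ))) :=
    FaithfulSMul.algebraMap_injective _ _
  have hint : ∀ z, IsIntegral ℤ (c z) := by
    intro z
    have : Module.Finite AlgInt (MonoidAlgebra AlgInt G) :=
      Module.Finite.equiv (MonoidAlgebra.coeffLinearEquiv AlgInt).symm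
    have h1 : IsIntegral AlgInt (L z.1) := (IsIntegral.of_finite AlgInt z.1).map L
    rw [hc, isIntegral_algebraMap_iff hinj] at h1
    exact isIntegral_trans _ h1
  let ω : GroupRingCenter G →ₐ[AlgInt] AlgInt :=
    { toFun := fun z => ⟨c z, hint z⟩
      map_one' := Subtype.ext <| hinj <| by simp [← hc]
      map_zero' := Subtype.ext <| hinj <| by simp [← hc]
      map_mul' := fun z w => Subtype.ext <| hinj <| by simp [← hc]
      map_add' := fun z w => Subtype.ext <| hinj <| by simp [← hc]
      commutes' := fun r => Subtype.ext <| hinj <| by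
        rw [← hc]
        exact L.commutes r }
  refine ⟨ω, fun z => ?_⟩
  have h2 : LinearMap.trace ℂ _ (L z.1) = c z * m := by
    rw [hc, Algebra.algebraMap_eq_smul_one, map_smul, LinearMap.trace_one]
    simp
  rw [h1]
  refine h2.symm.trans ?_
  rw [MonoidAlgebra.lift_apply, Finsupp.sum_fintype _ _ (by simp), map_sum]
  refine Finset.sum_congr rfl fun g _ => ?_
  exact map_smul (LinearMap.trace ℂ (Fin m → ℂ)) (z.1.coeff g : ℂ) (ρ g)

open scoped Classical in
/-- The sum of the conjugacy class of `x` in the group ring. -/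
def classSum (x : G) : GroupRingCenter G :=
  ⟨∑ g ∈ (ConjClasses.mk x).carrier.toFinset, MonoidAlgebra.of AlgInt G g, by
    rw [Subalgebra.mem_center_iff]
    intro b
    induction b using MonoidAlgebra.induction_on with
    | of h =>
      rw [Finset.mul_sum, Finset.sum_mul]
      refine Finset.sum_bij (fun g _ => h * g * h⁻¹) ?_ ?_ ?_ ?_
      · intro g hg
        rw [Set.mem_toFinset, ConjClasses.mem_carrier_iff_mk_eq] at hg ⊢
        rw [← hg, ConjClasses.mk_eq_mk_iff_isConj]
        exact (isConj_iff.2 ⟨h, rfl⟩).symm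
      · intro g _ g' _ hgg
        simpa using hgg
      · intro g hg
        refine ⟨h⁻¹ * g * h, ?_, by group⟩
        rw [Set.mem_toFinset, ConjClasses.mem_carrier_iff_mk_eq] at hg ⊢
        rw [← hg, ConjClasses.mk_eq_mk_iff_isConj]
        exact (isConj_iff.2 ⟨h⁻¹, by simp⟩).symm
      · intro g _
        rw [← map_mul, ← map_mul]
        simp
    | add a b ha hb => rw [add_mul, mul_add, ha, hb]
    | smul r a ha => rw [smul_mul_assoc, mul_smul_comm, ha]⟩

theorem sum_coeff_classSum {χ : G → ℂ} (hχ : χ ∈ OrdinaryIrr G) (x : G) :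
    ∑ g, ((classSum x).1.coeff g : ℂ) * χ g = (ConjClasses.mk x).carrier.ncard * χ x := by
  classical
  have : ∀ g, ((classSum x).1.coeff g : ℂ) = if g ∈ (ConjClasses.mk x).carrier then 1 else 0 := by
    intro g
    simp only [classSum, MonoidAlgebra.coeff_sum, MonoidAlgebra.of_apply, Finsupp.finsetSum_apply]
    simp [Finsupp.single_apply, apply_ite]
  simp only [this, ite_mul, one_mul, zero_mul]
  rw [← Finset.sum_filter, Finset.sum_congr rfl
    (fun g hg => apply_eq_of_mem_carrier hχ (Finset.mem_filter.1 hg).2)]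
  rw [Finset.sum_const, nsmul_eq_mul, Set.ncard_eq_toFinset_card']
  congr 3
  ext; simp

/-- The weights `χ(1)²` assemble the regular character, which detects only the coefficient at `1`.
-/
theorem sum_centralCharacter_mul_sq (ω : (G → ℂ) → GroupRingCenter G →ₐ[AlgInt] AlgInt)
    (hω : ∀ χ ∈ OrdinaryIrr G, ∀ z, (ω χ z : ℂ) * χ 1 = ∑ g, (z.1.coeff g : ℂ) * χ g)
    (z : GroupRingCenter G) :
    ∑ χ ∈ (finite_ordinaryIrr (G := G)).toFinset, (ω χ z : ℂ) * χ 1 ^ 2 =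
      Nat.card G * (z.1.coeff 1 : ℂ) := by
  classical
  calc _ = ∑ χ ∈ (finite_ordinaryIrr (G := G)).toFinset, ∑ g,
        (z.1.coeff g : ℂ) * (χ 1 * χ g) := by
        refine Finset.sum_congr rfl fun χ hχ => ?_
        rw [sq, ← mul_assoc, hω χ (by simpa using hχ), Finset.sum_mul]
        exact Finset.sum_congr rfl fun g _ => by ring
    _ = _ := by
        rw [Finset.sum_comm]
        simp only [← Finset.mul_sum, sum_apply_one_mul_apply]
        simp [mul_comm]

/-- Each `g` in the class contributes the coefficient of `z` at `g⁻¹`, and coefficients of a central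
element are constant on classes. -/
theorem coeff_classSum_mul (x : G) (z : GroupRingCenter G) :
    (classSum x * z).1.coeff 1 = (ConjClasses.mk x).carrier.ncard * z.1.coeff x⁻¹ := by
  classical
  have hz : ∀ g ∈ (ConjClasses.mk x).carrier, z.1.coeff g⁻¹ = z.1.coeff x⁻¹ := by
    intro g hg
    rw [ConjClasses.mem_carrier_iff_mk_eq, ConjClasses.mk_eq_mk_iff_isConj] at hg
    obtain ⟨c, rfl⟩ := isConj_iff.1 hg.symm
    have h := congrArg (fun a => a.coeff (c * x⁻¹))
      (Subalgebra.mem_center_iff.1 z.2 (MonoidAlgebra.of AlgInt G c))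
    simp only [MonoidAlgebra.of_apply, MonoidAlgebra.coeff_single_mul_apply,
      MonoidAlgebra.coeff_mul_single_apply] at h
    simpa [mul_assoc] using h.symm
  have : (classSum x * z).1 =
      ∑ g ∈ (ConjClasses.mk x).carrier.toFinset, MonoidAlgebra.of AlgInt G g * z.1 := by
    rw [← Finset.sum_mul]
    rfl
  rw [this, MonoidAlgebra.coeff_sum, Finsupp.finsetSum_apply]
  simp only [MonoidAlgebra.of_apply, MonoidAlgebra.coeff_single_mul_apply, one_mul, mul_one]
  rw [Finset.sum_congr rfl (fun g hg => hz g (by simpa using hg)), Finset.sum_const, nsmul_eq_mul,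
    Set.ncard_eq_toFinset_card']

end CentralCharacters

/-! ### Blocks and the count of height zero characters -/

section Blocks

variable {G : Type*} [Group G] {F : Type*} [Field F]

theorem reducesTo_coe_iff (red : AlgInt →+* F) (y : AlgInt) (α : F) :
    ReducesTo red y α ↔ red y = α := by
  constructor
  · rintro ⟨r, s, hs, h, rfl⟩
    have hs0 : (s : ℂ) ≠ 0 := by
      intro h0
      apply hs
      rw [show s = 0 from Subtype.ext h0, map_zero]
    rw [eq_div_iff hs0] at h
    have h' : y * s = r := Subtype.ext h
    rw [eq_div_iff hs, ← map_mul, h']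
  · rintro rfl
    exact ⟨y, 1, by simp, by simp, by simp⟩

/-- A central character of the group ring for each irreducible character. -/
def IsCentralCharacterFamily [Fintype G] (ω : (G → ℂ) → GroupRingCenter G →ₐ[AlgInt] AlgInt) :
    Prop :=
  ∀ χ ∈ OrdinaryIrr G, ∀ z, (ω χ z : ℂ) * χ 1 = ∑ g, (z.1.coeff g : ℂ) * χ g

theorem exists_isCentralCharacterFamily [Fintype G] :
    ∃ ω : (G → ℂ) → GroupRingCenter G →ₐ[AlgInt] AlgInt, IsCentralCharacterFamily ω := by
  classical
  have h : ∀ χ : G → ℂ, ∃ ω : GroupRingCenter G →ₐ[AlgInt] AlgInt, χ ∈ OrdinaryIrr G →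
      ∀ z, (ω z : ℂ) * χ 1 = ∑ g, (z.1.coeff g : ℂ) * χ g := by
    intro χ
    by_cases hχ : χ ∈ OrdinaryIrr G
    · obtain ⟨ω, hω⟩ := exists_centralCharacter hχ
      exact ⟨ω, fun _ => hω⟩
    -- Off `Irr(G)` any algebra map serves as a default; `Irr(G)` is nonempty since the regular
    -- character does not vanish at `1`.
    · obtain ⟨χ', hχ'⟩ : (OrdinaryIrr G).Nonempty := by
        by_contra h
        have := sum_apply_one_mul_apply (1 : G)
        simp [Set.not_nonempty_iff_eq_empty.1 h, eq_comm] at this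
      obtain ⟨ω, -⟩ := exists_centralCharacter hχ'
      exact ⟨ω, fun h => absurd h hχ⟩
  choose ω hω using h
  exact ⟨ω, hω⟩

variable [Fintype G] {ω : (G → ℂ) → GroupRingCenter G →ₐ[AlgInt] AlgInt}

theorem IsCentralCharacterFamily.classSum_mul (hω : IsCentralCharacterFamily ω) {χ : G → ℂ}
    (hχ : χ ∈ OrdinaryIrr G) (x : G) :
    (ω χ (classSum x) : ℂ) * χ 1 = (ConjClasses.mk x).carrier.ncard * χ x := by
  rw [hω χ hχ, sum_coeff_classSum hχ]

theorem IsCentralCharacterFamily.classSum_eq (hω : IsCentralCharacterFamily ω) {χ : G → ℂ}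
    (hχ : χ ∈ OrdinaryIrr G) (x : G) :
    (ConjClasses.mk x).carrier.ncard * χ x / χ 1 = (ω χ (classSum x) : ℂ) := by
  obtain ⟨n, hn, h1⟩ := exists_pos_nat_of_mem_ordinaryIrr hχ
  rw [div_eq_iff (by rw [h1]; exact_mod_cast hn.ne'), hω.classSum_mul hχ]

theorem IsCentralCharacterFamily.mem_irrOfBlock_iff (hω : IsCentralCharacterFamily ω) {p : ℕ}
    {red : AlgInt →+* F} {B : Set ((G → ℂ) ⊕ (PRegular p G → ℂ))} {lam : ConjClasses G → F}
    (hB : IsBlockWithCentralCharacter p red B lam) {χ : G → ℂ} :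
    χ ∈ irrOfBlock B ↔
      χ ∈ OrdinaryIrr G ∧ ∀ x, red (ω χ (classSum x)) = lam (ConjClasses.mk x) := by
  rw [irrOfBlock, Set.mem_ofPred_eq, hB.2]
  refine and_congr_right fun hχ => forall_congr' fun x => ?_
  rw [hω.classSum_eq hχ, reducesTo_coe_iff]

/-- An element of the centre of the group ring that is annihilated by the central characters
outside of a block, and on which those in the block have the same nonzero reduction. -/
theorem IsCentralCharacterFamily.exists_separating (hω : IsCentralCharacterFamily ω) {p : ℕ}
    {red : AlgInt →+* F} {B : Set ((G → ℂ) ⊕ (PRegular p G → ℂ))} {lam : ConjClasses G → F}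
    (hB : IsBlockWithCentralCharacter p red B lam) :
    ∃ z : GroupRingCenter G, ∃ u : F, u ≠ 0 ∧ (∀ χ ∈ irrOfBlock B, red (ω χ z) = u) ∧
      ∀ χ ∈ OrdinaryIrr G, χ ∉ irrOfBlock B → ω χ z = 0 := by
  classical
  have h : ∀ χ : G → ℂ, ∃ x, χ ∈ OrdinaryIrr G → χ ∉ irrOfBlock B →
      red (ω χ (classSum x)) ≠ lam (ConjClasses.mk x) := by
    intro χ
    by_contra! h
    exact (h 1).2.1 ((hω.mem_irrOfBlock_iff hB).2 ⟨(h 1).1, fun x => (h x).2.2⟩)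
  choose x hx using h
  let s := (finite_ordinaryIrr (G := G)).toFinset.filter (· ∉ irrOfBlock B)
  have hs : ∀ χ, χ ∈ s ↔ χ ∈ OrdinaryIrr G ∧ χ ∉ irrOfBlock B := by simp [s]
  -- One factor `K - ω_χ(K)` for each `χ` outside `B`, with `K` a class where the reduction of `ω_χ`
  -- differs from `λ_B`: `ω_χ` kills its own factor, while on `B` each factor reduces to a nonzero
  -- constant.
  refine ⟨∏ χ ∈ s, (classSum (x χ) + algebraMap AlgInt _ (-ω χ (classSum (x χ)))),
    ∏ χ ∈ s, (lam (ConjClasses.mk (x χ)) - red (ω χ (classSum (x χ)))), ?_, ?_, ?_⟩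
  · refine Finset.prod_ne_zero_iff.2 fun χ hχ => sub_ne_zero.2 ?_
    rw [hs] at hχ
    exact (hx χ hχ.1 hχ.2).symm
  · intro ψ hψ
    rw [map_prod, map_prod]
    refine Finset.prod_congr rfl fun χ _ => ?_
    rw [map_add, AlgHom.commutes, map_add, ((hω.mem_irrOfBlock_iff hB).1 hψ).2, sub_eq_add_neg]
    exact congrArg _ (map_neg red _)
  · intro χ hχ hχB
    rw [map_prod]
    refine Finset.prod_eq_zero ((hs χ).2 ⟨hχ, hχB⟩) ?_
    rw [map_add, AlgHom.commutes]
    exact add_neg_cancel _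

theorem ringHom_natCast_ne_zero {p : ℕ} [CharP F p] (red : AlgInt →+* F) {n : ℕ} (h : ¬ p ∣ n) :
    red (n : AlgInt) ≠ 0 := by
  rwa [map_natCast, Ne, CharP.cast_eq_zero_iff F p]

/-- If `χ(1)_p` were smaller than `p^e`, cancelling it in `ω_χ(K) χ(1) = |K| χ(x)` would make a
prime-to-`p` multiple of `ω_χ(K)` divisible by `p`, so `ω_χ(K)` would reduce to zero. -/
theorem IsCentralCharacterFamily.pow_dvd_degree (hω : IsCentralCharacterFamily ω) {p : ℕ}
    [hp : Fact p.Prime] [CharP F p] {red : AlgInt →+* F} {χ : G → ℂ} (hχ : χ ∈ OrdinaryIrr G)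
    {n : ℕ} (hn : χ 1 = n) {x : G} (hx : red (ω χ (classSum x)) ≠ 0) {e : ℕ}
    (he : p ^ e ∣ (ConjClasses.mk x).carrier.ncard) : p ^ e ∣ n := by
  have hn0 : n ≠ 0 := by
    rintro rfl
    obtain ⟨n, h0, h1⟩ := exists_pos_nat_of_mem_ordinaryIrr hχ
    rw [h1] at hn
    exact h0.ne' (by exact_mod_cast hn)
  obtain ⟨f, m, hm, rfl⟩ := Nat.exists_eq_pow_mul_and_not_dvd hn0 p hp.out.ne_one
  obtain ⟨k, hk⟩ := he
  by_contra hfe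
  have hlt : f < e := by
    by_contra h
    exact hfe (Dvd.dvd.mul_right (pow_dvd_pow p (not_lt.1 h)) m)
  have h := hω.classSum_mul hχ x
  rw [hn, hk] at h
  obtain ⟨d, rfl⟩ := Nat.exists_eq_add_of_lt hlt
  have hχx : χ x ∈ AlgInt := isIntegral_apply hχ x
  have h2 : (m : AlgInt) * ω χ (classSum x) = p * (p ^ d * k * ⟨χ x, hχx⟩) := by
    refine Subtype.ext ?_
    have hp0 : ((p : ℂ) ^ f) ≠ 0 := pow_ne_zero _ (Nat.cast_ne_zero.2 hp.out.ne_zero)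
    refine mul_left_cancel₀ hp0 ?_
    push_cast at h ⊢
    linear_combination h
  have h3 := congrArg red h2
  rw [map_mul, map_mul, map_natCast red p, CharP.cast_eq_zero F p, zero_mul, mul_eq_zero] at h3
  exact h3.elim (ringHom_natCast_ne_zero red hm) hx

/-- The only place where `p ≤ 3` matters: for `p ≥ 5`, `2² = 4` is not `1` mod `p`. -/
theorem sq_modEq_ite {p : ℕ} (hp : p = 2 ∨ p = 3) (d : ℕ) :
    d ^ 2 ≡ if p ∣ d then 0 else 1 [MOD p] := by
  rcases hp with rfl | rfl
  · have := Nat.mod_lt d (by norm_num : 2 > 0)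
    rw [Nat.ModEq, Nat.pow_mod]
    split_ifs with h <;> interval_cases h2 : d % 2 <;> simp <;> omega
  · have := Nat.mod_lt d (by norm_num : 3 > 0)
    rw [Nat.ModEq, Nat.pow_mod]
    split_ifs with h <;> interval_cases h2 : d % 3 <;> simp <;> omega

theorem dvd_ncard_irrHeightZero {p : ℕ} [hp : Fact p.Prime] (hp23 : p = 2 ∨ p = 3)
    [CharP F p] {red : AlgInt →+* F} {B : Set ((G → ℂ) ⊕ (PRegular p G → ℂ))}
    {lam : ConjClasses G → F} (hB : IsBlockWithCentralCharacter p red B lam) {x : G}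
    (hx : lam (ConjClasses.mk x) ≠ 0) {D : Subgroup G}
    (hD : padicValNat p D.index = padicValNat p (ConjClasses.mk x).carrier.ncard)
    {c : ℕ} (hc : Nat.card G = (ConjClasses.mk x).carrier.ncard * c) (hpc : p ∣ c) :
    p ∣ (irrHeightZero B D).ncard := by
  classical
  obtain ⟨ω, hω⟩ := exists_isCentralCharacterFamily (G := G)
  obtain ⟨z, u, hu, hzB, hz0⟩ := hω.exists_separating hB
  have hmem := fun χ => hω.mem_irrOfBlock_iff hB (χ := χ)
  set κ := (ConjClasses.mk x).carrier.ncard with hκ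
  have hκ0 : κ ≠ 0 := by
    rintro h
    rw [h, zero_mul] at hc
    exact Nat.card_pos.ne' hc
  obtain ⟨e, k, hk, hke⟩ := Nat.exists_eq_pow_mul_and_not_dvd hκ0 p hp.out.ne_one
  obtain ⟨c', rfl⟩ := hpc
  let s := (finite_ordinaryIrr (G := G)).toFinset.filter (· ∈ irrOfBlock B)
  have hs : ∀ χ, χ ∈ s ↔ χ ∈ irrOfBlock B := fun χ => by
    simpa [s] using fun h => ((hmem χ).1 h).1
  have hd : ∀ χ, ∃ d : ℕ, χ ∈ irrOfBlock B → χ 1 = (p ^ e * d : ℕ) ∧ d ≠ 0 := by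
    intro χ
    by_cases hχ : χ ∈ irrOfBlock B
    · obtain ⟨hirr, hl⟩ := (hmem χ).1 hχ
      obtain ⟨n, hn, h1⟩ := exists_pos_nat_of_mem_ordinaryIrr hirr
      obtain ⟨d, rfl⟩ := hω.pow_dvd_degree hirr h1 (x := x) (by rwa [hl])
        (Dvd.intro _ hke.symm : p ^ e ∣ κ)
      exact ⟨d, fun _ => ⟨h1, by rintro rfl; simp at hn⟩⟩
    · exact ⟨0, fun h => absurd h hχ⟩
  choose d hd using hd
  have hsum := sum_centralCharacter_mul_sq ω hω (classSum x * z)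
  rw [← Finset.sum_filter_add_sum_filter_not _ (· ∈ irrOfBlock B), coeff_classSum_mul,
    ← hκ, hc, hke] at hsum
  have hzero : ∑ χ ∈ finite_ordinaryIrr.toFinset with χ ∉ irrOfBlock B,
      (ω χ (classSum x * z) : ℂ) * χ 1 ^ 2 = 0 := by
    refine Finset.sum_eq_zero fun χ hχ => ?_
    simp only [Finset.mem_filter, Set.Finite.mem_toFinset] at hχ
    rw [map_mul, hz0 χ hχ.1 hχ.2]
    simp
  rw [hzero, add_zero] at hsum
  -- The identity is divided by `p^(2e)` before reducing; the surviving factor `p` on the right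
  -- comes from the centralizer order `c = p c'`.
  have hsum' : ∑ χ ∈ s, ω χ (classSum x) * ω χ z * (d χ : AlgInt) ^ 2 =
      p * (k ^ 2 * c' * z.1.coeff x⁻¹) := by
    refine Subtype.ext ?_
    have hp0 : ((p : ℂ) ^ e) ^ 2 ≠ 0 :=
      pow_ne_zero _ (pow_ne_zero _ (Nat.cast_ne_zero.2 hp.out.ne_zero))
    refine mul_left_cancel₀ hp0 ?_
    have : ∑ χ ∈ s, (ω χ (classSum x * z) : ℂ) * χ 1 ^ 2 =
        ((p : ℂ) ^ e) ^ 2 * ∑ χ ∈ s, (ω χ (classSum x) : ℂ) * ω χ z * (d χ : ℂ) ^ 2 := by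
      rw [Finset.mul_sum]
      refine Finset.sum_congr rfl fun χ hχ => ?_
      rw [(hd χ ((hs χ).1 hχ)).1, map_mul]
      push_cast
      ring
    push_cast at hsum ⊢
    rw [← this]
    refine hsum.trans ?_
    ring
  have hF := congrArg red hsum'
  rw [map_mul, map_natCast, CharP.cast_eq_zero, zero_mul, map_sum] at hF
  have hF' : lam (ConjClasses.mk x) * u * ((∑ χ ∈ s, d χ ^ 2 : ℕ) : F) = 0 := by
    rw [← hF, Nat.cast_sum, Finset.mul_sum]
    refine Finset.sum_congr rfl fun χ hχ => ?_
    have hχB := (hs χ).1 hχ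
    rw [map_mul, map_mul, ((hmem χ).1 hχB).2, hzB χ hχB]
    simp
  have hdvd : p ∣ ∑ χ ∈ s, d χ ^ 2 :=
    (CharP.cast_eq_zero_iff F p _).1 ((mul_eq_zero.1 hF').resolve_left (mul_ne_zero hx hu))
  have hcard : ∑ χ ∈ s, d χ ^ 2 ≡ (s.filter fun χ => ¬ p ∣ d χ).card [MOD p] := by
    rw [Finset.card_filter]
    refine Nat.ModEq.sum fun χ _ => ?_
    refine (sq_modEq_ite hp23 _).trans ?_
    rw [ite_not]
  have heq : irrHeightZero B D = (s.filter fun χ => ¬ p ∣ d χ : Finset (G → ℂ)) := by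
    ext χ
    rw [irrHeightZero, Set.mem_ofPred_eq, Finset.coe_filter, Set.mem_ofPred_eq, hs]
    refine and_congr_right fun hχ => ?_
    obtain ⟨h1, hd0⟩ := hd χ hχ
    have hval : ∀ d : ℕ, d ≠ 0 → padicValNat p (p ^ e * d) = e + padicValNat p d := fun d hd => by
      rw [padicValNat.mul (pow_ne_zero _ hp.out.ne_zero) hd, padicValNat.prime_pow]
    have hk0 : k ≠ 0 := by rintro rfl; exact hk (dvd_zero p)
    rw [hD, hke, hval k hk0, padicValNat.eq_zero_of_not_dvd hk, h1]
    constructor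
    · rintro ⟨n, hn, h2⟩ hpd
      rw [← Nat.cast_injective hn, hval _ hd0] at h2
      have := one_le_padicValNat_of_dvd hd0 hpd
      omega
    · intro hpd
      exact ⟨_, rfl, by rw [hval _ hd0, padicValNat.eq_zero_of_not_dvd hpd]⟩
  rw [heq, Set.ncard_coe_finset]
  exact (hcard.dvd_iff dvd_rfl).1 hdvd

end Blocks

/-! ### The Galois action on characters and blocks -/

section GaloisAction

/-- Over a transcendence basis of `ℂ/K`, `σ` acts on the coefficients of polynomials, and `ℂ` is an
algebraic closure of that polynomial ring. -/
theorem exists_ringEquiv_extending {K : IntermediateField ℚ ℂ} (σ : Gal(K/ℚ)) :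
    ∃ s : ℂ ≃+* ℂ, ∀ z : K, s z = σ z := by
  obtain ⟨S, hS⟩ := exists_isTranscendenceBasis K ℂ
  let A := Algebra.adjoin K (Set.range ((↑) : S → ℂ))
  have : IsAlgClosure A ℂ := IsAlgClosed.isAlgClosure_of_transcendence_basis _ hS
  let e : A ≃+* A := hS.1.aevalEquiv.symm.toRingEquiv.trans
    ((MvPolynomial.mapEquiv S σ.toRingEquiv).trans hS.1.aevalEquiv.toRingEquiv)
  have he : ∀ z : K, e (algebraMap K A z) = algebraMap K A (σ z) := by
    intro z
    change hS.1.aevalEquiv (MvPolynomial.map (σ : K →+* K)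
      (hS.1.aevalEquiv.symm (algebraMap K A z))) = _
    rw [AlgEquiv.commutes, MvPolynomial.algebraMap_eq, MvPolynomial.map_C,
      ← MvPolynomial.algebraMap_eq, AlgEquiv.commutes]
    rfl
  refine ⟨IsAlgClosure.equivOfEquiv ℂ ℂ e, fun z => ?_⟩
  have h := IsAlgClosure.equivOfEquiv_algebraMap ℂ ℂ e (algebraMap K A z)
  rw [he] at h
  exact h

theorem rootOfUnity_mem_QAb {z : ℂ} {n : ℕ} (hn : n ≠ 0) (hz : z ^ n = 1) : z ∈ QAb :=
  IntermediateField.subset_adjoin _ _ ⟨n, hn, hz⟩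

theorem IsSigmaOne.exists_pow {p : ℕ} [hp : Fact p.Prime] {σ : Gal(QAb/ℚ)} (hσ : IsSigmaOne p σ)
    {a m : ℕ} (hm : ¬ p ∣ m) :
    ∃ u : ℕ, u ≡ p + 1 [MOD p ^ a] ∧ u ≡ 1 [MOD m] ∧
      ∀ z : QAb, z ^ (p ^ a * m) = 1 → σ z = z ^ u := by
  have hcop : Nat.Coprime (p ^ a) m :=
    Nat.Coprime.pow_left a ((Nat.Prime.coprime_iff_not_dvd hp.out).2 hm)
  obtain ⟨u, hu1, hu2⟩ := Nat.chineseRemainder hcop (p + 1) 1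
  -- The exponents `b` and `c` split `z` into its `p`-part `z ^ b` and its `p'`-part `z ^ c`.
  obtain ⟨b, hb1, hb2⟩ := Nat.chineseRemainder hcop 1 0
  obtain ⟨c, hc1, hc2⟩ := Nat.chineseRemainder hcop 0 1
  refine ⟨u, hu1, hu2, fun z hz => ?_⟩
  have h1 : z = z ^ b * z ^ c := by
    rw [← pow_add]
    conv_lhs => rw [← pow_one z]
    refine pow_eq_pow_of_modEq ?_ hz
    exact (Nat.modEq_and_modEq_iff_modEq_mul hcop).1
      ⟨(hb1.add hc1).symm, (hb2.add hc2).symm⟩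
  have h2 : σ (z ^ b) = (z ^ b) ^ (p + 1) := by
    refine hσ.2 _ a ?_
    obtain ⟨d, rfl⟩ := (Nat.modEq_zero_iff_dvd).1 hb2
    rw [← pow_mul, show m * d * p ^ a = p ^ a * m * d by ring, pow_mul, hz, one_pow]
  have h3 : σ (z ^ c) = z ^ c := by
    refine hσ.1 _ m hm ?_
    obtain ⟨d, rfl⟩ := (Nat.modEq_zero_iff_dvd).1 hc1
    rw [← pow_mul, show p ^ a * d * m = p ^ a * m * d by ring, pow_mul, hz, one_pow]
  conv_lhs => rw [h1, map_mul, h2, h3, ← pow_mul, ← pow_add]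
  refine pow_eq_pow_of_modEq ?_ hz
  refine (Nat.modEq_and_modEq_iff_modEq_mul hcop).1 ⟨?_, ?_⟩
  · simpa using ((hb1.mul_right (p + 1)).add hc1).trans (by simpa using hu1.symm)
  · simpa using ((hb2.mul_right (p + 1)).add hc2).trans (by simpa using hu2.symm)

variable {G : Type*} [Group G]

/-- Applying `s` to matrix entries gives a representation that is semilinearly equivalent to the
original one by `s` on coordinates. -/
theorem ringEquiv_comp_mem_ordinaryIrr (s : ℂ ≃+* ℂ) {χ : G → ℂ} (hχ : χ ∈ OrdinaryIrr G) :
    (fun g => s (χ g)) ∈ OrdinaryIrr G := by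
  obtain ⟨n, ρ, hρ, rfl⟩ := hχ
  let φ : Module.End ℂ (Fin n → ℂ) →* Module.End ℂ (Fin n → ℂ) :=
    (Matrix.toLinAlgEquiv' (R := ℂ) (n := Fin n)).toAlgHom.toMonoidHom.comp
      ((RingHom.mapMatrix (m := Fin n) (s : ℂ →+* ℂ)).toMonoidHom.comp
        (LinearMap.toMatrixAlgEquiv' (R := ℂ) (n := Fin n)).toAlgHom.toMonoidHom)
  have hφ : ∀ f, φ f = Matrix.toLin' ((LinearMap.toMatrix' f).map s) := fun f => rfl
  let τ : Representation ℂ G (Fin n → ℂ) := φ.comp ρ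
  let _ := RingHomInvPair.of_ringEquiv s
  let _ := RingHomInvPair.symm (s : ℂ →+* ℂ) (s.symm : ℂ →+* ℂ)
  let e : (Fin n → ℂ) ≃ₛₗ[(s : ℂ →+* ℂ)] (Fin n → ℂ) :=
    { toFun := fun v i => s (v i)
      invFun := fun v i => s.symm (v i)
      map_add' := fun v w => by ext; simp
      map_smul' := fun c v => by ext; simp
      left_inv := fun v => by ext; simp
      right_inv := fun v => by ext; simp }
  refine ⟨n, τ, isIrreducible_of_semilinearEquiv e (fun g v => ?_) hρ, ?_⟩
  · change e (ρ g v) = φ (ρ g) (e v)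
    rw [hφ]
    ext i
    change s (ρ g v i) = ∑ j, s (LinearMap.toMatrix' (ρ g) i j) * s (v j)
    rw [← LinearMap.toMatrix'_mulVec]
    simp only [Matrix.mulVec, dotProduct, map_sum, map_mul]
  · ext g
    change s (LinearMap.trace ℂ _ (ρ g)) = LinearMap.trace ℂ _ (φ (ρ g))
    rw [hφ, Matrix.trace_toLin'_eq]
    rw [LinearMap.trace_eq_matrix_trace ℂ (Pi.basisFun ℂ (Fin n)), Matrix.trace, map_sum]
    rfl

theorem ringEquiv_apply_character [Finite G] {s : ℂ ≃+* ℂ} {u : ℕ}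
    (hs : ∀ ζ : ℂ, ζ ^ Nat.card G = 1 → s ζ = ζ ^ u) {χ : G → ℂ} (hχ : χ ∈ OrdinaryIrr G) (g : G) :
    s (χ g) = χ (g ^ u) := by
  obtain ⟨l, hl, h⟩ := exists_eigenvalues hχ g
  have h1 := h 1
  simp only [pow_one, Multiset.map_id'] at h1
  rw [h1, h, map_multiset_sum]
  exact congrArg _ (Multiset.map_congr rfl fun ζ hζ => hs ζ (hl ζ hζ))

/-- Replaces the Galois action by the power map on `G`, whose iterates are easy to compute. -/
theorem isGaloisFixed_iff [Finite G] {σ : Gal(QAb/ℚ)} {u : ℕ}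
    (hu : ∀ z : QAb, z ^ Nat.card G = 1 → σ z = z ^ u) {χ : G → ℂ} (hχ : χ ∈ OrdinaryIrr G) :
    IsGaloisFixed σ χ ↔ (fun g => χ (g ^ u)) = χ := by
  obtain ⟨s, hs⟩ := exists_ringEquiv_extending σ
  have hN : Nat.card G ≠ 0 := Nat.card_pos.ne'
  have hsu : ∀ ζ : ℂ, ζ ^ Nat.card G = 1 → s ζ = ζ ^ u := by
    intro ζ hζ
    have h := hu ⟨ζ, rootOfUnity_mem_QAb hN hζ⟩ (Subtype.ext hζ)
    exact (hs ⟨ζ, rootOfUnity_mem_QAb hN hζ⟩).trans (congrArg Subtype.val h)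
  rw [funext_iff]
  refine forall_congr' fun g => ?_
  rw [← ringEquiv_apply_character hsu hχ]
  constructor
  · rintro ⟨z, hz, hz'⟩
    rw [← hz, hs, hz']
  · intro h
    have hmem : χ g ∈ QAb := by
      obtain ⟨l, hl, h⟩ := exists_eigenvalues hχ g
      have h1 := h 1
      simp only [pow_one, Multiset.map_id'] at h1
      rw [h1]
      exact multiset_sum_mem _ fun ζ hζ => rootOfUnity_mem_QAb hN (hl ζ hζ)
    exact ⟨⟨χ g, hmem⟩, rfl, Subtype.ext ((hs ⟨χ g, hmem⟩).symm.trans h)⟩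

/-- `ℤ[ζ]` is the full ring of integers of `ℚ(ζ)`, so a statement about reductions need only be
checked at `ζ`. -/
theorem mem_adjoin_of_isIntegral {N : ℕ} [NeZero N] {ζ : ℂ} (hζ : IsPrimitiveRoot ζ N) {y : ℂ}
    (hy : y ∈ IntermediateField.adjoin ℚ {ζ}) (hint : IsIntegral ℤ y) :
    y ∈ Algebra.adjoin ℤ {ζ} := by
  let K := IntermediateField.adjoin ℚ {ζ}
  have : IsCyclotomicExtension {N} ℚ K := by
    change IsCyclotomicExtension {N} ℚ (IntermediateField.adjoin ℚ {ζ}).toSubalgebra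
    rw [IntermediateField.adjoin_simple_toSubalgebra_of_isAlgebraic
      ((hζ.isIntegral (NeZero.pos N)).tower_top (A := ℚ)).isAlgebraic]
    exact hζ.adjoin_isCyclotomicExtension ℚ
  have : NumberField K := IsCyclotomicExtension.numberField {N} ℚ K
  let ζK : K := ⟨ζ, IntermediateField.mem_adjoin_simple_self ℚ ζ⟩
  have hζK : IsPrimitiveRoot ζK N :=
    IsPrimitiveRoot.of_map_of_injective (f := K.val) hζ Subtype.val_injective
  have hyK : IsIntegral ℤ (⟨y, hy⟩ : K) :=
    (isIntegral_algHom_iff (K.val.restrictScalars ℤ) Subtype.val_injective).1 hint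
  obtain ⟨w, hw⟩ := (IsCyclotomicExtension.Rat.isIntegralClosure_adjoin_singleton
    (n := N) hζK).isIntegral_iff.1 hyK
  have h : K.val.restrictScalars ℤ w.1 ∈
      (Algebra.adjoin ℤ {ζK}).map (K.val.restrictScalars ℤ) := Subalgebra.mem_map.2 ⟨w.1, w.2, rfl⟩
  rw [AlgHom.map_adjoin_singleton] at h
  rw [show y = K.val.restrictScalars ℤ w.1 from (congrArg Subtype.val hw).symm]
  exact h

theorem red_eq_of_ringEquiv {F : Type*} [Field F] {p : ℕ} [hp : Fact p.Prime] [CharP F p]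
    (red : AlgInt →+* F) {a m : ℕ} (hN : p ^ a * m ≠ 0) {u : ℕ} (hu : u ≡ 1 [MOD m])
    {s : ℂ ≃+* ℂ} (hs : ∀ ζ : ℂ, ζ ^ (p ^ a * m) = 1 → s ζ = ζ ^ u) {ζ : ℂ}
    (hζ : IsPrimitiveRoot ζ (p ^ a * m)) {y y' : AlgInt}
    (hy : (y : ℂ) ∈ IntermediateField.adjoin ℚ {ζ}) (hy' : (y' : ℂ) = s y) :
    red y' = red y := by
  have : NeZero (p ^ a * m) := ⟨hN⟩
  have hint : IsIntegral ℤ ζ :=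
    IsIntegral.of_pow (Nat.pos_of_ne_zero hN) (by rw [hζ.pow_eq_one]; exact isIntegral_one)
  let ζR : AlgInt := ⟨ζ, hint⟩
  let sR : AlgInt →ₐ[ℤ] AlgInt := ((s : ℂ →+* ℂ).toIntAlgHom).mapIntegralClosure
  have hsR : ∀ r : AlgInt, (sR r : ℂ) = s r := fun r => rfl
  have hy1 : y ∈ Algebra.adjoin ℤ {ζR} := by
    have h := mem_adjoin_of_isIntegral hζ hy y.2
    rw [show ζ = AlgInt.val ζR from rfl, ← AlgHom.map_adjoin_singleton] at h
    obtain ⟨w, hw, hwy⟩ := h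
    rwa [← show w = y from Subtype.ext hwy]
  -- In characteristic `p` the `p`-part of a root of unity reduces to `1`, so `u ≡ 1` mod `m`
  -- suffices for `ζ` and `ζ ^ u` to have the same reduction.
  have ht : (red ζR) ^ m = 1 := by
    have : ExpChar F p := .prime hp.out
    rw [← ExpChar.pow_prime_pow_mul_eq_one_iff p a m, ← map_pow]
    rw [show ζR ^ (p ^ a * m) = 1 from Subtype.ext hζ.pow_eq_one, map_one]
  have heq : red.toIntAlgHom.comp sR ζR = red.toIntAlgHom ζR := by
    have h1 : sR ζR = ζR ^ u := Subtype.ext (hs ζ hζ.pow_eq_one)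
    change red (sR ζR) = red ζR
    rw [h1, map_pow]
    simpa using pow_eq_pow_of_modEq hu ht
  have hle : Algebra.adjoin ℤ {ζR} ≤ AlgHom.equalizer (red.toIntAlgHom.comp sR) red.toIntAlgHom :=
    Algebra.adjoin_le (Set.singleton_subset_iff.2 heq)
  have h2 : red (sR y) = red y := hle hy1
  rw [← h2]
  exact congrArg red (Subtype.ext hy')

/-- The central character of the twist is `s ∘ ω_χ` on class sums; these values are algebraic
integers in `ℚ(ζ)`, so twisting leaves their reductions unchanged. -/
theorem comp_pow_mem_irrOfBlock [Fintype G] {F : Type*} [Field F] {p : ℕ} [hp : Fact p.Prime]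
    [CharP F p] {red : AlgInt →+* F} {B : Set ((G → ℂ) ⊕ (PRegular p G → ℂ))}
    {lam : ConjClasses G → F} (hB : IsBlockWithCentralCharacter p red B lam) {a m u : ℕ}
    (hN : Nat.card G = p ^ a * m) (hu : u ≡ 1 [MOD m]) {s : ℂ ≃+* ℂ}
    (hs : ∀ ζ : ℂ, ζ ^ Nat.card G = 1 → s ζ = ζ ^ u) {χ : G → ℂ} (hχ : χ ∈ irrOfBlock B) :
    (fun g => χ (g ^ u)) ∈ irrOfBlock B := by
  obtain ⟨ω, hω⟩ := exists_isCentralCharacterFamily (G := G)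
  rw [hω.mem_irrOfBlock_iff hB] at hχ ⊢
  obtain ⟨hirr, hl⟩ := hχ
  have hχs : (fun g => χ (g ^ u)) = fun g => s (χ g) :=
    funext fun g => (ringEquiv_apply_character hs hirr g).symm
  have hirr' := ringEquiv_comp_mem_ordinaryIrr s hirr
  rw [hχs]
  refine ⟨hirr', fun x => ?_⟩
  rw [← hl x]
  have h0 : p ^ a * m ≠ 0 := hN ▸ Nat.card_pos.ne'
  have hζ := Complex.isPrimitiveRoot_exp _ h0
  refine red_eq_of_ringEquiv red h0 hu (by rwa [← hN]) hζ ?_ ?_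
  · rw [← hω.classSum_eq hirr x]
    have hval : ∀ g, χ g ∈ IntermediateField.adjoin ℚ
        {Complex.exp (2 * Real.pi * Complex.I / (p ^ a * m : ℕ))} := by
      intro g
      obtain ⟨l, hl, h⟩ := exists_eigenvalues hirr g
      have h1 := h 1
      simp only [pow_one, Multiset.map_id'] at h1
      rw [h1]
      refine multiset_sum_mem _ fun z hz => ?_
      have : NeZero (p ^ a * m) := ⟨h0⟩
      obtain ⟨j, -, rfl⟩ := hζ.eq_pow_of_pow_eq_one (hN ▸ hl z hz)
      exact pow_mem (IntermediateField.mem_adjoin_simple_self ℚ _) j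
    exact div_mem (mul_mem (natCast_mem _ _) (hval x)) (hval 1)
  · rw [← hω.classSum_eq hirr x, ← hω.classSum_eq hirr' x]
    simp

theorem pow_prime_pow_modEq_one {p : ℕ} [hp : Fact p.Prime] {a m u : ℕ} (hm : ¬ p ∣ m)
    (h1 : u ≡ p + 1 [MOD p ^ a]) (h2 : u ≡ 1 [MOD m]) : u ^ p ^ a ≡ 1 [MOD p ^ a * m] := by
  have hcop : Nat.Coprime (p ^ a) m :=
    Nat.Coprime.pow_left a ((Nat.Prime.coprime_iff_not_dvd hp.out).2 hm)
  refine (Nat.modEq_and_modEq_iff_modEq_mul hcop).1 ⟨?_, by simpa using h2.pow (p ^ a)⟩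
  -- For `a = 0` the hypothesis modulo `p ^ a` is empty and does not give `u ≡ 1` mod `p`.
  rcases Nat.eq_zero_or_pos a with rfl | ha
  · simp [Nat.modEq_one]
  have hp1 : u ≡ 1 [MOD p] := by
    simpa [Nat.ModEq] using h1.of_dvd (dvd_pow_self p ha.ne')
  have h3 : (p : ℤ) ∣ (u : ℤ) - 1 := (Nat.modEq_iff_dvd.1 hp1.symm)
  -- Each `p`th power gains a factor `p`, so `u ^ p ^ a ≡ 1` even modulo `p ^ (a + 1)`.
  have h4 := dvd_sub_pow_of_dvd_sub h3 a
  refine (Nat.modEq_iff_dvd.2 ?_).symm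
  push_cast
  rw [one_pow] at h4
  exact (pow_dvd_pow _ (Nat.le_succ a)).trans h4

theorem ncard_fixed_modEq {X : Type*} {p n : ℕ} [hp : Fact p.Prime] {S : Set X} (hS : S.Finite)
    {f : X → X} (hf : ∀ x ∈ S, f x ∈ S) (hfn : ∀ x ∈ S, f^[p ^ n] x = x) :
    S.ncard ≡ {x ∈ S | f x = x}.ncard [MOD p] := by
  classical
  have := hS.fintype
  let φ : Function.End S := fun x => ⟨f x, hf x x.2⟩
  have hφ : ∀ k (x : S), ((φ ^ k) x : X) = f^[k] x := by
    intro k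
    induction k with
    | zero => intro x; rfl
    | succ k ih => intro x; exact ih (φ x)
  have h := Equiv.Perm.card_fixedPoints_modEq (f := φ) (p := p) (n := n)
    (funext fun x => Subtype.ext ((hφ _ x).trans (hfn x x.2)))
  rw [← Nat.card_eq_fintype_card, ← Nat.card_eq_fintype_card] at h
  rw [← Nat.card_coe_set_eq, ← Nat.card_coe_set_eq]
  let e : Function.fixedPoints φ ≃ {x ∈ S | f x = x} :=
    { toFun := fun x => ⟨x.1.1, x.1.2, congrArg Subtype.val x.2⟩
      invFun := fun x => ⟨⟨x.1, x.2.1⟩, Subtype.ext x.2.2⟩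
      left_inv := fun x => rfl
      right_inv := fun x => rfl }
  rwa [← Nat.card_congr e]

end GaloisAction

/-! ### Numerical properties of defect groups -/

section DefectGroups

variable {G : Type*} [Group G]

theorem card_eq_ncard_carrier_mul [Finite G] (x : G) :
    Nat.card G = (ConjClasses.mk x).carrier.ncard *
      Nat.card (Subgroup.centralizer {x} : Subgroup G) := by
  rw [← ConjAct.orbit_eq_carrier_conjClasses, ← MulAction.index_stabilizer,
    Subgroup.nat_card_centralizer_nat_card_stabilizer, Subgroup.index_mul_card]
  rfl

theorem padicValNat_index_map_sylow [Finite G] {p : ℕ} [hp : Fact p.Prime] (C : Subgroup G)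
    (P : Sylow p C) :
    padicValNat p ((P : Subgroup C).map C.subtype).index = padicValNat p C.index := by
  rw [Subgroup.index_map_subtype,
    padicValNat.mul Subgroup.index_ne_zero_of_finite Subgroup.index_ne_zero_of_finite,
    padicValNat.eq_zero_of_not_dvd (P.not_dvd_index), zero_add]

/-- With `C = C_G(x)`, this is how a nontrivial defect group supplies the extra factor `p` in the
count. -/
theorem dvd_card_of_map_sylow_ne_bot [Finite G] {p : ℕ} [hp : Fact p.Prime] (C : Subgroup G)
    (P : Sylow p C) (hP : (P : Subgroup C).map C.subtype ≠ ⊥) : p ∣ Nat.card C := by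
  by_contra h
  have hP' : (P : Subgroup C) = ⊥ := by
    rw [← Subgroup.card_eq_one]
    obtain ⟨k, hk⟩ := P.2.exists_card_eq
    rw [hk]
    rcases Nat.eq_zero_or_pos k with rfl | hk0
    · simp
    · exact absurd ((dvd_pow_self p hk0.ne').trans
        (hk ▸ Subgroup.card_subgroup_dvd_card (P : Subgroup C))) h
  exact hP (by rw [hP', Subgroup.map_bot])

end DefectGroups

end

/-! ### The main theorem -/

theorem lemma1p5 {G : Type*} [Group G] [Finite G] (p : ℕ) [Fact p.Prime] (hp : p = 2 ∨ p = 3)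
    {F : Type*} [Field F] [CharP F p]
    (red : integralClosure ℤ ℂ →+* F) (hred : Function.Surjective red)
    (B : Set ((G → ℂ) ⊕ (PRegular p G → ℂ))) (hB : IsBlock p red B)
    (D : Subgroup G) (hD : IsDefectGroup red B D) (hD1 : D ≠ ⊥) :
    p ∣ {χ ∈ irrHeightZero B D | IsGaloisFixed (sigmaOne p) χ}.ncard := by
  have := Fintype.ofFinite G
  obtain ⟨x, ⟨-, lam, hlam, hx⟩, P, hDP⟩ := hD
  have hc := card_eq_ncard_carrier_mul x
  have hpC := dvd_card_of_map_sylow_ne_bot _ P (hDP ▸ hD1)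
  have hval : padicValNat p D.index = padicValNat p (ConjClasses.mk x).carrier.ncard := by
    rw [hDP, padicValNat_index_map_sylow]
    congr 1
    have h := (Subgroup.centralizer {x} : Subgroup G).card_mul_index
    rw [hc, mul_comm] at h
    exact Nat.eq_of_mul_eq_mul_right Nat.card_pos h
  have hdvd := dvd_ncard_irrHeightZero hp hlam hx hval hc hpC
  obtain ⟨a, m, hm, hN⟩ := Nat.exists_eq_pow_mul_and_not_dvd (Nat.card_pos (α := G)).ne' p
    (Fact.out : p.Prime).ne_one
  obtain ⟨u, hu1, hu2, hu⟩ := (sigmaOne_spec p).exists_pow (a := a) hm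
  rw [← hN] at hu
  obtain ⟨s, hs⟩ := exists_ringEquiv_extending (sigmaOne p)
  have hsu : ∀ ζ : ℂ, ζ ^ Nat.card G = 1 → s ζ = ζ ^ u := by
    intro ζ hζ
    have hmem := rootOfUnity_mem_QAb Nat.card_pos.ne' hζ
    exact (hs ⟨ζ, hmem⟩).trans (congrArg Subtype.val (hu ⟨ζ, hmem⟩ (Subtype.ext hζ)))
  have hirr : ∀ χ ∈ irrHeightZero B D, χ ∈ OrdinaryIrr G := by
    intro χ hχ
    have h : Sum.inl χ ∈ B := hχ.1
    rw [hlam.2] at h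
    exact h.1
  let T : (G → ℂ) → (G → ℂ) := fun χ g => χ (g ^ u)
  have hTk : ∀ k χ, T^[k] χ = fun g => χ (g ^ u ^ k) := by
    intro k
    induction k with
    | zero => intro χ; simp
    | succ k ih =>
      intro χ
      rw [Function.iterate_succ_apply, ih]
      funext g
      simp only [T, ← pow_mul, pow_succ]
  have hmod := pow_prime_pow_modEq_one hm hu1 hu2
  rw [← hN] at hmod
  have hcard := ncard_fixed_modEq (p := p) (n := a) (S := irrHeightZero B D) (f := T)
    (finite_ordinaryIrr.subset hirr)
    -- The height is preserved because `1 ^ u = 1` leaves the degree unchanged.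
    (fun χ hχ => ⟨comp_pow_mem_irrOfBlock hlam hN hu2 hsu hχ.1, by simpa [T] using hχ.2⟩)
    (fun χ hχ => by
      rw [hTk]
      funext g
      rw [pow_eq_pow_of_modEq hmod pow_card_eq_one', pow_one])
  have heq : {χ ∈ irrHeightZero B D | IsGaloisFixed (sigmaOne p) χ} =
      {χ ∈ irrHeightZero B D | T χ = χ} := by
    ext χ
    exact and_congr_right fun hχ => isGaloisFixed_iff hu (hirr χ hχ)
  rw [heq]
  exact (hcard.dvd_iff dvd_rfl).1 hdvd
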